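/- Let $q\ge 5$ be a power of an odd prime, let $n=(q^2+1)/2$, and let $i$ be an integer with $2\le i\le \frac{n-1}{2}-1$. Then there exists an MDS convolutional code over $\mathbb F_{q^2}$ with parameters $(n,\,n-2i+1,\,2;\,1,\,2i+2)$. Moreover, the code can be obtained from negacyclic BCH codes in the following way. For some primitive $2n$-th root of unity $\beta$ in an algebraic closure of $\mathbb F_{q^2}$, let $M^{(j)}(x)$ be the minimal polynomial of $\beta^j$ over $\mathbb F_{q^2}$, and let $C_2$, $C_1$, $C_0$ be the negacyclic codes of length $n$ (ideals of $\mathbb F_{q^2}[x]/(x^n+1)$) generated by $M^{(n)}M^{(n+2)}\cdots M^{(n+2i)}$, by $M^{(n)}M^{(n+2)}\cdots M^{(n+2i-2)}$ and by $M^{(n+2i)}$, respectively. There are parity check matrices $H_1$ of $C_1$, with $2i-1$ rows, and $H_0$ of $C_0$, with $2$ rows, all with linearly independent rows, such that $\begin{bmatrix}H_1\\H_0\end{bmatrix}$ is a parity check matrix of $C_2$ with linearly independent rows and the convolutional code is the Hermitian dual of the $\mathbb F_{q^2}[D]$-module generated by the rows of $H_1+\tilde H_0D$, where $\tilde H_0$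 is $H_0$ with zero rows added at the bottom. Here a convolutional code with parameters $(n,k,\gamma;\mu,d_f)$ over a field $F$ is a submodule $\{u(D)G(D): u(D)\in F[D]^k\}$ of $F[D]^n$, where $G=(g_{rj})\in F[D]^{k\times n}$ has a polynomial right inverse and, among all such generator matrices of the same code, the smallest value of $\gamma=\sum_r\gamma_r$ with $\gamma_r=\max_j\deg g_{rj}$; moreover $\mu=\max_r\gamma_r$, and $d_f$ is the minimum, over the nonzero $v(D)$ in the code, of the number of nonzero coefficients of $v(D)$. It is MDS if $d_f=(n-k)(\lfloor\gamma/k\rfloor+1)+\gamma+1$. The Hermitian dual of a submodule $V$ of $\mathbb F_{q^2}[D]^n$ is the set of all $u(D)$ such that $\langle D^tu\mid v\rangle=0$ for all $t\ge 0$ and $v\in V$, where $\langle \sum_s u_sD^s\mid\sum_s v_sD^s\rangle=\sum_s u_s\cdot v_s^{\,q}$, with $v_s^{\,q}$ taken entrywise. -/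

import Mathlib

open Polynomial

noncomputable section

namespace ConvCode

variable {F : Type*} [Field F]

/-! ### Convolutional codes as submodules of `F[D]^n` -/

/-- The constraint length `γ_r = max_j deg g_{rj}` of row `r` of a polynomial matrix. -/
def rowDegree {k n : ℕ} (G : Matrix (Fin k) (Fin n) F[X]) (r : Fin k) : ℕ :=
  Finset.univ.sup fun j => (G r j).natDegree

/-- The overall constraint length `∑ γ_r`. -/
def overallLength {k n : ℕ} (G : Matrix (Fin k) (Fin n) F[X]) : ℕ :=
  ∑ r, rowDegree G r

/-- The memory `max_r γ_r`. -/
def memory {k n : ℕ} (G : Matrix (Fin k) (Fin n) F[X]) : ℕ :=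
  Finset.univ.sup fun r => rowDegree G r

/-- The module `{u(D) G(D)}` generated by the rows of `G(D)`. -/
def rowModule {k n : ℕ} (G : Matrix (Fin k) (Fin n) F[X]) : Submodule F[X] (Fin n → F[X]) :=
  LinearMap.range G.vecMulLinear

/-- `G(D)` is basic: it has a polynomial right inverse. -/
def IsBasic {k n : ℕ} (G : Matrix (Fin k) (Fin n) F[X]) : Prop :=
  ∃ R : Matrix (Fin n) (Fin k) F[X], G * R = 1

/-- `G(D)` is reduced basic: it is basic and its overall constraint length is the smallest
among all basic generator matrices of the same code. -/
def IsReducedBasic {k n : ℕ} (G : Matrix (Fin k) (Fin n) F[X]) : Prop :=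
  IsBasic G ∧ ∀ G' : Matrix (Fin k) (Fin n) F[X], IsBasic G' → rowModule G' = rowModule G →
    overallLength G ≤ overallLength G'

/-- The Hamming weight of `v(D)`: the total number of nonzero coefficients of its entries. -/
def weight {n : ℕ} (v : Fin n → F[X]) : ℕ :=
  ∑ j, (v j).support.card

/-- `C` is a convolutional code with parameters `(n, k, γ; μ, d)`: dimension `k`, degree `γ`,
memory `μ` and free distance `d`. -/
def HasParameters {n : ℕ} (C : Submodule F[X] (Fin n → F[X])) (k γ μ d : ℕ) : Prop :=
  (∃ G : Matrix (Fin k) (Fin n) F[X],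
    IsReducedBasic G ∧ rowModule G = C ∧ overallLength G = γ ∧ memory G = μ) ∧
  IsLeast {w : ℕ | ∃ v ∈ C, v ≠ 0 ∧ weight v = w} d

/-- `C` is an `(n, k, γ; μ, d)` convolutional code that attains the generalized Singleton bound
`d ≤ (n - k) (⌊γ / k⌋ + 1) + γ + 1`. -/
def IsMDS {n : ℕ} (C : Submodule F[X] (Fin n → F[X])) (k γ μ d : ℕ) : Prop :=
  HasParameters C k γ μ d ∧ d = (n - k) * (γ / k + 1) + γ + 1

/-! ### The Hermitian dual -/

/-- The Hermitian inner product `⟨u(D) | v(D)⟩ = ∑_t u_t · v_t^q` of polynomial vectors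
`u(D) = ∑_t u_t D^t`, `v(D) = ∑_t v_t D^t`. -/
def hermitianForm (q : ℕ) {n : ℕ} (u v : Fin n → F[X]) : F :=
  ∑ j, (u j).sum fun t a => a * (v j).coeff t ^ q

/-- The Hermitian dual of the code `V`: the vectors `u(D)` all of whose shifts `D^t u(D)`
(equivalently, all of whose polynomial multiples) are orthogonal to `V`. -/
def hermitianDual (q : ℕ) {n : ℕ} (V : Submodule F[X] (Fin n → F[X])) :
    Submodule F[X] (Fin n → F[X]) where
  carrier := {u | ∀ p : F[X], ∀ v ∈ V, hermitianForm q (p • u) v = 0}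
  zero_mem' := by
    intro p v _
    simp [hermitianForm]
  add_mem' := by
    intro a b ha hb p v hv
    have h1 : hermitianForm q (p • (a + b)) v
        = hermitianForm q (p • a) v + hermitianForm q (p • b) v := by
      simp only [hermitianForm, smul_add, Pi.add_apply, ← Finset.sum_add_distrib]
      refine Finset.sum_congr rfl fun j _ => ?_
      exact Polynomial.sum_add_index _ _ _ (by simp) (by intros; ring)
    rw [h1, ha p v hv, hb p v hv, add_zero]
  smul_mem' := by
    intro c u hu p v hv
    rw [smul_smul]
    exact hu (p * c) v hv

/-! ### Negacyclic codes -/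

/-- The identification of `(c_0, …, c_{n-1})` with the class of `c_0 + c_1 x + ⋯ + c_{n-1} x^{n-1}`
in `F[x] / (x^n + 1)`. -/
def toNegacyclicRing (F : Type*) [Field F] (n : ℕ) :
    (Fin n → F) →ₗ[F] AdjoinRoot (X ^ n + 1 : F[X]) :=
  Fintype.linearCombination F fun j : Fin n => AdjoinRoot.root (X ^ n + 1 : F[X]) ^ (j : ℕ)

/-- The negacyclic code of length `n` generated by `g(x)`, i.e. the set of vectors corresponding to
the ideal of `F[x] / (x^n + 1)` generated by the class of `g(x)`. -/
def negacyclicCode (n : ℕ) (g : F[X]) : Submodule F (Fin n → F) :=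
  ((Ideal.span {AdjoinRoot.mk (X ^ n + 1 : F[X]) g}).restrictScalars F).comap
    (toNegacyclicRing F n)

/-- The product `M^{(b)}(x) M^{(b+2)}(x) ⋯ M^{(b+2(s-1))}(x)` of `s` minimal polynomials over `F`,
where `M^{(j)}` is the minimal polynomial of `β^j`. -/
def bchGenerator (F : Type*) [Field F] {K : Type*} [Field K] [Algebra F K]
    (β : K) (b s : ℕ) : F[X] :=
  ∏ t ∈ Finset.range s, minpoly F (β ^ (b + 2 * t))

/-- `H` is a parity check matrix of the block code `C`: its rows are linearly independent, and
`C` is the set of vectors that it annihilates. -/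
def IsParityCheck {ρ : Type*} {n : ℕ} (H : Matrix ρ (Fin n) F)
    (C : Submodule F (Fin n → F)) : Prop :=
  LinearIndependent F H.row ∧ ∀ c : Fin n → F, c ∈ C ↔ H.mulVec c = 0

/-! ### Convolutional codes from block codes -/

/-- Zero rows are added at the bottom of `H` to obtain `κ` rows in total (used for `r ≤ κ`). -/
def padRows {r n : ℕ} (κ : ℕ) (H : Matrix (Fin r) (Fin n) F) : Matrix (Fin κ) (Fin n) F :=
  Matrix.of fun a j => if h : (a : ℕ) < r then H ⟨a, h⟩ j else 0

/-- The polynomial matrix `H₁ + H̃₀ D`, where `H̃₀` is `H₀` padded with zero rows at the bottom. -/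
def unitMemoryMatrix {κ r n : ℕ} (H₁ : Matrix (Fin κ) (Fin n) F)
    (H₀ : Matrix (Fin r) (Fin n) F) : Matrix (Fin κ) (Fin n) F[X] :=
  Matrix.of fun a j => C (H₁ a j) + C (padRows κ H₀ a j) * X

end ConvCode

end

noncomputable section

namespace ConvCode

/-! ### Codes with parity check matrix `H̃₀ + H₁ D`: generators, degree and free distance. -/

section UnitMemory

variable {F : Type*} [Field F] {κ r m n : ℕ}

/-! With `σ` the `q`-th power map, the Hermitian dual of the module generated by `H₁ + H̃₀ D` is the
kernel of the reciprocal matrix `H̃₀^σ + H₁^σ D` (`hermitianDual_rowModule`). This reduces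
everything to block codes.

Distance: in a nonzero word of the kernel the lowest coefficient is annihilated by `H₀^σ` and the
highest by `H₁^σ`. If they coincide, it lies in the conjugate of `C₂`; otherwise the weights add up.
So the free distance is at least `min (d C₂) (d C₁ + d C₀)`, and constant words from `C₂` show
sharpness (`hasParameters_checkCode`).

Degree: completing `[H₁; H₀]` to an invertible matrix solves the kernel equations explicitly, with
`r` rows of degree one and the others constant (`exists_generator`). No basic generator matrix does
better, because its constant rows are independent words of the conjugate of `C₂`
(`le_overallLength`).

Block codes: since `|F| + 1 = q² + 1 = 2n`, Frobenius inverts every `2n`-th root of unity. Hence the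
product of `M^(n), …, M^(n+2s)` has the `2s+1` roots `β^(n-2s), β^(n-2s+2), …, β^(n+2s)`. The BCH
bound gives distance at least `2s+2`, and the generator polynomial itself has at most that weight.
Thus `C₂` has distance `2i+2`, which `C₁` and `C₀` match with at least `2i` and `2`. -/

theorem linearIndependent_row_of_surjective {ι : Type*} [Fintype ι]
    {A : Matrix ι (Fin n) F} (hA : Function.Surjective A.mulVec) : LinearIndependent F A.row := by
  classical
  rw [← Matrix.vecMul_injective_iff]
  obtain ⟨B, hB⟩ := Matrix.mulVec_surjective_iff_exists_right_inverse.1 hA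
  intro v w h
  simpa [Matrix.vecMul_vecMul, hB] using congrArg (fun x => Matrix.vecMul x B) h

/-- A matrix with independent rows is the top part of an invertible square matrix. -/
theorem exists_invertible_extension {ι : Type*} [Fintype ι] [DecidableEq ι]
    {A : Matrix ι (Fin n) F} (hA : Function.Surjective A.mulVec) (hm : Fintype.card ι + m = n) :
    ∃ (T : Matrix (ι ⊕ Fin m) (Fin n) F) (S : Matrix (Fin n) (ι ⊕ Fin m) F),
      T * S = 1 ∧ S * T = 1 ∧ ∀ x j, T (Sum.inl x) j = A x j := by
  classical
  have hli := linearIndependent_row_of_surjective hA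
  let b := Module.Basis.sumExtend hli
  have : Fintype (ι ⊕ ↑(Module.Basis.sumExtendIndex hli)) :=
    FiniteDimensional.fintypeBasisIndex b
  have : Fintype ↑(Module.Basis.sumExtendIndex hli) :=
    Fintype.ofInjective (Sum.inr : _ → ι ⊕ ↑(Module.Basis.sumExtendIndex hli)) Sum.inr_injective
  have hc : Fintype.card ↑(Module.Basis.sumExtendIndex hli) = Fintype.card (Fin m) := by
    have h1 := Module.finrank_eq_nat_card_basis b
    rw [Module.finrank_fin_fun, Nat.card_sum, Nat.card_eq_fintype_card,
      Nat.card_eq_fintype_card] at h1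
    rw [Fintype.card_fin]
    omega
  let e := Fintype.equivOfCardEq hc
  let b' := b.reindex (Equiv.sumCongr (Equiv.refl ι) e)
  let T : Matrix (ι ⊕ Fin m) (Fin n) F := Matrix.of fun x => b' x
  have hT : LinearIndependent F T.row := b'.linearIndependent
  have hcard : Fintype.card (Fin n) = Fintype.card (ι ⊕ Fin m) := by simp [hm]
  let f := Fintype.equivOfCardEq hcard
  have hT' : LinearIndependent F (T.submatrix id f.symm).row := by
    rw [← Matrix.vecMul_injective_iff] at hT ⊢
    intro v w hvw
    apply hT
    ext j
    have := congrFun hvw (f j)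
    simpa [Matrix.vecMul, dotProduct] using this
  rw [Matrix.linearIndependent_rows_iff_isUnit] at hT'
  have hdet := (Matrix.isUnit_iff_isUnit_det _).1 hT'
  refine ⟨T, ((T.submatrix id f.symm)⁻¹).submatrix f id, ?_, ?_, ?_⟩
  · have h := Matrix.mul_nonsing_inv _ hdet
    rw [← h]
    ext x y
    simp only [Matrix.mul_apply, Matrix.submatrix_apply, id]
    exact (Equiv.sum_comp f.symm _).symm.trans (by simp)
  · have h := Matrix.nonsing_inv_mul _ hdet
    ext x y
    have h2 := congrFun (congrFun h (f x)) (f y)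
    simp only [Matrix.mul_apply, Matrix.submatrix_apply, id, Equiv.symm_apply_apply] at h2 ⊢
    rw [h2]
    simp [Matrix.one_apply]
  · intro x j
    have hb : b' (Sum.inl x) = A x := by
      simp only [b', b, Module.Basis.sumExtend, Module.Basis.reindex_apply,
        Module.Basis.extend_apply_self]
      rfl
    exact congrFun hb j

/-- The polynomial matrix `H̃₀ + H₁ D`. -/
def reciprocalMatrix (A₁ : Matrix (Fin κ) (Fin n) F) (A₀ : Matrix (Fin r) (Fin n) F) :
    Matrix (Fin κ) (Fin n) F[X] :=
  Matrix.of fun a j => C (padRows κ A₀ a j) + C (A₁ a j) * X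

/-- The convolutional code with parity check matrix `H̃₀ + H₁ D`. -/
def checkCode (A₁ : Matrix (Fin κ) (Fin n) F) (A₀ : Matrix (Fin r) (Fin n) F) :
    Submodule F[X] (Fin n → F[X]) :=
  LinearMap.ker (reciprocalMatrix A₁ A₀).mulVecLin

/-- The `t`-th coefficient of a polynomial vector. -/
def coeffVec (u : Fin n → F[X]) (t : ℕ) : Fin n → F := fun j => (u j).coeff t

variable {A₁ : Matrix (Fin κ) (Fin n) F} {A₀ : Matrix (Fin r) (Fin n) F}

theorem padRows_mulVec (c : Fin n → F) (a : Fin κ) :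
    (padRows κ A₀).mulVec c a = if h : (a : ℕ) < r then A₀.mulVec c ⟨a, h⟩ else 0 := by
  by_cases h : (a : ℕ) < r <;> simp [padRows, Matrix.mulVec, dotProduct, h]

/-- Comparing coefficients of `D^t` turns membership into a recursion linking consecutive
coefficient vectors. -/
theorem mem_checkCode_iff {u : Fin n → F[X]} :
    u ∈ checkCode A₁ A₀ ↔ (padRows κ A₀).mulVec (coeffVec u 0) = 0 ∧
      ∀ t, (padRows κ A₀).mulVec (coeffVec u (t + 1)) + A₁.mulVec (coeffVec u t) = 0 := by
  have h0 : ∀ a, ((reciprocalMatrix A₁ A₀).mulVec u a).coeff 0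
      = (padRows κ A₀).mulVec (coeffVec u 0) a := by
    intro a
    simp [reciprocalMatrix, Matrix.mulVec, dotProduct, coeffVec, add_mul,
      mul_coeff_zero]
  have h1 : ∀ a t, ((reciprocalMatrix A₁ A₀).mulVec u a).coeff (t + 1)
      = ((padRows κ A₀).mulVec (coeffVec u (t + 1)) + A₁.mulVec (coeffVec u t)) a := by
    intro a t
    simp [reciprocalMatrix, Matrix.mulVec, dotProduct, coeffVec, add_mul,
      mul_assoc, Finset.sum_add_distrib]
  constructor
  · intro h
    have h' : (reciprocalMatrix A₁ A₀).mulVec u = 0 := h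
    refine ⟨funext fun a => ?_, fun t => funext fun a => ?_⟩
    · rw [← h0, h']; rfl
    · rw [← h1, h']; rfl
  · rintro ⟨ha, hb⟩
    refine show (reciprocalMatrix A₁ A₀).mulVec u = 0 from funext fun a => ?_
    ext t
    cases t with
    | zero => rw [h0, ha]; rfl
    | succ t => rw [h1, hb]; rfl

theorem mulVec_eq_zero_of_padRows (hr : r ≤ κ) {c : Fin n → F}
    (h : (padRows κ A₀).mulVec c = 0) : A₀.mulVec c = 0 := by
  funext b
  have := congrFun h (Fin.castLE hr b)
  simpa [padRows_mulVec] using this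

/-- Constant words serve twice: they bound the number of constant generator rows, and they attain
the free distance. -/
theorem const_mem_checkCode_iff (hr : r ≤ κ) {c : Fin n → F} :
    (fun j => C (c j)) ∈ checkCode A₁ A₀ ↔ A₁.mulVec c = 0 ∧ A₀.mulVec c = 0 := by
  have e0 : coeffVec (fun j => C (c j)) 0 = c := by funext j; simp [coeffVec]
  have e1 : ∀ t, coeffVec (fun j => C (c j)) (t + 1) = 0 := by
    intro t; funext j; simp [coeffVec]
  rw [mem_checkCode_iff, e0]
  constructor
  · rintro ⟨h0, h1⟩
    have := h1 0
    rw [e1, e0, Matrix.mulVec_zero, zero_add] at this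
    exact ⟨this, mulVec_eq_zero_of_padRows hr h0⟩
  · rintro ⟨h1, h0⟩
    refine ⟨?_, fun t => ?_⟩
    · funext a; rw [padRows_mulVec, h0]; simp
    · rw [e1, Matrix.mulVec_zero, zero_add]
      cases t with
      | zero => rw [e0, h1]
      | succ t => rw [e1, Matrix.mulVec_zero]

/-! ### Free distance from the extreme coefficients. -/

section Distance

variable [DecidableEq F]

theorem weight_const (c : Fin n → F) : weight (fun j => C (c j)) = hammingNorm c := by
  unfold weight hammingNorm
  rw [Finset.card_filter]
  refine Finset.sum_congr rfl fun j _ => ?_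
  by_cases h : c j = 0
  · simp [h]
  · simp [support_C h, h]

theorem sum_hammingNorm_coeffVec_le (u : Fin n → F[X]) (s : Finset ℕ) :
    ∑ t ∈ s, hammingNorm (coeffVec u t) ≤ weight u := by
  unfold weight hammingNorm
  simp_rw [Finset.card_filter]
  rw [Finset.sum_comm]
  refine Finset.sum_le_sum fun j _ => ?_
  rw [← Finset.card_filter]
  refine Finset.card_le_card fun t ht => ?_
  rw [mem_support_iff]
  exact (Finset.mem_filter.1 ht).2

/-- The free distance is at least `min d (d₁ + d₀)`, where `d`, `d₁`, `d₀` bound the distances of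
the block codes with parity check matrices `[H₁; H₀]`, `H₁`, `H₀`. -/
theorem le_weight_of_mem_checkCode (hr : r ≤ κ) {d d₁ d₀ : ℕ} (hd : d ≤ d₁ + d₀)
    (h : ∀ c, A₁.mulVec c = 0 → A₀.mulVec c = 0 → c ≠ 0 → d ≤ hammingNorm c)
    (h₁ : ∀ c, A₁.mulVec c = 0 → c ≠ 0 → d₁ ≤ hammingNorm c)
    (h₀ : ∀ c, A₀.mulVec c = 0 → c ≠ 0 → d₀ ≤ hammingNorm c)
    {u : Fin n → F[X]} (hu : u ∈ checkCode A₁ A₀) (hu0 : u ≠ 0) : d ≤ weight u := by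
  classical
  obtain ⟨hz, hs⟩ := mem_checkCode_iff.1 hu
  have hex : ∃ t, coeffVec u t ≠ 0 := by
    by_contra! hcon
    apply hu0
    funext j
    ext t
    exact congrFun (hcon t) j
  set s := Nat.find hex with hsdef
  have hs0 : coeffVec u s ≠ 0 := Nat.find_spec hex
  have hmin : ∀ t < s, coeffVec u t = 0 := fun t ht => by
    simpa using Nat.find_min hex ht
  -- Coefficient `s - 1` vanishes, so the equation there keeps only its `A₀` term; dually, `l + 1`
  -- being zero leaves only `A₁` at `l`.
  have hA0 : A₀.mulVec (coeffVec u s) = 0 := by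
    apply mulVec_eq_zero_of_padRows hr
    rcases hse : s with _ | t
    · exact hz
    · have := hs t
      rwa [hmin t (by omega), Matrix.mulVec_zero, add_zero] at this
  let N := Finset.univ.sup fun j => (u j).natDegree
  have hN : ∀ t, coeffVec u t ≠ 0 → t ≤ N := by
    intro t ht
    obtain ⟨j, hj⟩ := Function.ne_iff.1 ht
    exact (le_natDegree_of_ne_zero hj).trans
      (Finset.le_sup (f := fun j => (u j).natDegree) (Finset.mem_univ j))
  set l := Nat.findGreatest (fun t => coeffVec u t ≠ 0) N with hl
  have hl0 : coeffVec u l ≠ 0 :=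
    Nat.findGreatest_spec (P := fun t => coeffVec u t ≠ 0) (hN s hs0) hs0
  have hl1 : coeffVec u (l + 1) = 0 := by
    by_contra hne
    have := Nat.le_findGreatest (P := fun t => coeffVec u t ≠ 0) (hN _ hne) hne
    omega
  have hA1 : A₁.mulVec (coeffVec u l) = 0 := by
    have := hs l
    rwa [hl1, Matrix.mulVec_zero, zero_add] at this
  by_cases hsl : s = l
  · have := sum_hammingNorm_coeffVec_le u {s}
    rw [Finset.sum_singleton] at this
    exact (h _ (hsl ▸ hA1) hA0 hs0).trans this
  · have := sum_hammingNorm_coeffVec_le u {s, l}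
    rw [Finset.sum_pair hsl] at this
    have a1 := h₁ _ hA1 hl0
    have a0 := h₀ _ hA0 hs0
    omega

end Distance

/-- Every basic generator matrix of the code has at least `r` nonconstant rows. -/
theorem le_overallLength (hr : r ≤ κ) (hA : Function.Surjective (Matrix.fromRows A₁ A₀).mulVec)
    (hn : κ + r + m = n) {G : Matrix (Fin (r + m)) (Fin n) F[X]} (hG : IsBasic G)
    (hC : rowModule G = checkCode A₁ A₀) : r ≤ overallLength G := by
  classical
  -- The constant rows are independent elements of the `m`-dimensional kernel `K`, so at most `m` of
  -- the `r + m` rows are constant.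
  let Z := Finset.univ.filter fun x => rowDegree G x = 0
  have hconst : ∀ x : Z, ∀ j, G x j = C ((G x j).coeff 0) := by
    intro x j
    apply eq_C_of_natDegree_eq_zero
    have hx := (Finset.mem_filter.1 x.2).2
    have : (G x j).natDegree ≤ rowDegree G x :=
      Finset.le_sup (f := fun j => (G x j).natDegree) (Finset.mem_univ j)
    omega
  let K := LinearMap.ker (Matrix.fromRows A₁ A₀).mulVecLin
  have hK : Module.finrank F K = m := by
    have h1 := LinearMap.finrank_range_add_finrank_ker (Matrix.fromRows A₁ A₀).mulVecLin
    have h2 : LinearMap.range (Matrix.fromRows A₁ A₀).mulVecLin = ⊤ :=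
      LinearMap.range_eq_top.2 hA
    rw [h2, finrank_top] at h1
    simp at h1
    change _ + Module.finrank F K = n at h1
    omega
  have hrow : ∀ x : Z, (fun j => (G x j).coeff 0) ∈ K := by
    intro x
    have h1 : (fun j => G x j) ∈ checkCode A₁ A₀ := by
      rw [← hC]
      exact ⟨Pi.single x.1 1, by simp; rfl⟩
    have h2 : (fun j => G x j) = fun j => C ((G x j).coeff 0) := funext (hconst x)
    rw [h2, const_mem_checkCode_iff hr] at h1
    change (Matrix.fromRows A₁ A₀).mulVec _ = 0
    rw [Matrix.fromRows_mulVec, h1.1, h1.2]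
    funext y
    cases y <;> rfl
  have hli : LinearIndependent F (Matrix.of fun x j => (G x j).coeff 0).row := by
    obtain ⟨R, hR⟩ := hG
    rw [← Matrix.vecMul_injective_iff]
    -- Setting `D = 0` in `G R = 1` leaves a right inverse over `F`.
    have hR0 : (Matrix.of fun x j => (G x j).coeff 0) * (Matrix.of fun j x => (R j x).coeff 0)
        = (1 : Matrix (Fin (r + m)) (Fin (r + m)) F) := by
      ext x y
      have := congrArg (fun p => p.coeff 0) (congrFun (congrFun hR x) y)
      simp only [Matrix.mul_apply, finsetSum_coeff, mul_coeff_zero] at this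
      simp only [Matrix.mul_apply, Matrix.of_apply, this, Matrix.one_apply]
      split_ifs <;> simp
    intro v w h
    simpa [Matrix.vecMul_vecMul, hR0] using
      congrArg (fun x => Matrix.vecMul x (Matrix.of fun j x => (R j x).coeff 0)) h
  have hli2 : LinearIndependent F (fun x : Z => (⟨_, hrow x⟩ : K)) := by
    apply LinearIndependent.of_comp K.subtype
    exact hli.comp (fun x : Z => x.1) Subtype.val_injective
  have hcard := hli2.fintype_card_le_finrank
  rw [hK, Fintype.card_coe] at hcard
  have hsplit := Finset.card_filter_add_card_filter_not
    (s := (Finset.univ : Finset (Fin (r + m)))) (fun x => rowDegree G x = 0)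
  rw [Finset.card_univ, Fintype.card_fin] at hsplit
  have hle : (Finset.univ.filter fun x => ¬ rowDegree G x = 0).card ≤ overallLength G := by
    unfold overallLength
    rw [Finset.card_filter]
    refine Finset.sum_le_sum fun x _ => ?_
    split_ifs <;> omega
  change Z.card ≤ m at hcard
  change Z.card + _ = _ at hsplit
  omega

/-- The code has a basic generator matrix with `r` rows of degree `1` and `m` constant rows. -/
theorem exists_generator (hr : r ≤ κ) (hr0 : 0 < r)
    (hA : Function.Surjective (Matrix.fromRows A₁ A₀).mulVec) (hn : κ + r + m = n) :
    ∃ G : Matrix (Fin (r + m)) (Fin n) F[X], IsBasic G ∧ rowModule G = checkCode A₁ A₀ ∧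
      overallLength G = r ∧ memory G = 1 := by
  classical
  obtain ⟨T, S, hTS, hST, hT⟩ := exists_invertible_extension (m := m) hA (by simpa using hn)
  have hT1 : ∀ a j, T (Sum.inl (Sum.inl a)) j = A₁ a j := fun a j => by simp [hT]
  have hT0 : ∀ b j, T (Sum.inl (Sum.inr b)) j = A₀ b j := fun b j => by simp [hT]
  let ι : Fin r → Fin κ := Fin.castLE hr
  -- In the coordinates `w = T u` the kernel equations read `w₀ b = -D w₁ (ι b)`, with `w₁ a = 0`
  -- for `a ≥ r`. The free coordinates are `w₁ (ι b)` and the last `m`; the columns of `S = T⁻¹`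
  -- translate back.
  let g : Fin r ⊕ Fin m → Fin n → F[X] := Sum.elim
    (fun b j => C (S j (Sum.inl (Sum.inl (ι b)))) - C (S j (Sum.inl (Sum.inr b))) * X)
    (fun c j => C (S j (Sum.inr c)))
  let G : Matrix (Fin (r + m)) (Fin n) F[X] := Matrix.of fun x j => g (finSumFinEquiv.symm x) j
  have hTSe : ∀ x y, ∑ j, T x j * S j y = if x = y then 1 else 0 := fun x y => by
    have := congrFun (congrFun hTS x) y
    rwa [Matrix.mul_apply, Matrix.one_apply] at this
  have hSTe : ∀ x y, ∑ j, S x j * T j y = if x = y then 1 else 0 := fun x y => by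
    have := congrFun (congrFun hST x) y
    rwa [Matrix.mul_apply, Matrix.one_apply] at this
  have hTg : ∀ x b, ∑ j, g (Sum.inl b) j * C (T x j)
      = C (if x = Sum.inl (Sum.inl (ι b)) then 1 else 0)
        - C (if x = Sum.inl (Sum.inr b) then 1 else 0) * X := fun x b => by
    rw [← hTSe, ← hTSe, map_sum, map_sum, Finset.sum_mul, ← Finset.sum_sub_distrib]
    refine Finset.sum_congr rfl fun j _ => ?_
    simp only [g, Sum.elim_inl, C_mul]
    ring
  have hTg' : ∀ x c, ∑ j, g (Sum.inr c) j * C (T x j)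
      = C (if x = Sum.inr c then 1 else 0) := fun x c => by
    rw [← hTSe, map_sum]
    refine Finset.sum_congr rfl fun j _ => ?_
    simp only [g, Sum.elim_inr, C_mul]
    ring
  -- membership in terms of the coordinates `T u`
  have hw : ∀ (u : Fin n → F[X]) a, (reciprocalMatrix A₁ A₀).mulVec u a
      = (if h : (a : ℕ) < r then ∑ j, u j * C (T (Sum.inl (Sum.inr ⟨a, h⟩)) j) else 0)
        + (∑ j, u j * C (T (Sum.inl (Sum.inl a)) j)) * X := by
    intro u a
    simp only [reciprocalMatrix, Matrix.mulVec, dotProduct, Matrix.of_apply, add_mul,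
      Finset.sum_add_distrib, padRows, hT1, hT0]
    congr 1
    · split_ifs with h
      · exact Finset.sum_congr rfl fun j _ => mul_comm _ _
      · simp
    · rw [Finset.sum_mul]
      exact Finset.sum_congr rfl fun j _ => by ring
  have hgmem : ∀ x, g x ∈ checkCode A₁ A₀ := by
    intro x
    refine show (reciprocalMatrix A₁ A₀).mulVec (g x) = 0 from funext fun a => ?_
    rw [hw]
    rcases x with b | c
    · simp only [hTg]
      by_cases hab : a = ι b
      · have hlt : (a : ℕ) < r := by rw [hab]; exact b.2
        have hb : (⟨a, hlt⟩ : Fin r) = b := by ext; simp [hab, ι]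
        simp [hab, ι]
      · have hb : ∀ hlt : (a : ℕ) < r, (⟨a, hlt⟩ : Fin r) ≠ b := by
          intro hlt h
          apply hab
          ext
          simp [ι, ← h]
        by_cases hlt : (a : ℕ) < r
        · simp [hab, hlt, hb hlt]
        · simp [hab, hlt]
    · simp only [hTg']
      split_ifs <;> simp_all
  refine ⟨G, ?_, ?_, ?_, ?_⟩
  -- The right inverse reads off the free coordinates through the matching rows of `T`.
  · refine ⟨Matrix.of fun j x => C (T (Sum.elim (fun b => Sum.inl (Sum.inl (ι b)))
      Sum.inr (finSumFinEquiv.symm x)) j), ?_⟩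
    ext1 x y
    rw [Matrix.mul_apply]
    obtain ⟨x, rfl⟩ := finSumFinEquiv.surjective x
    obtain ⟨y, rfl⟩ := finSumFinEquiv.surjective y
    simp only [G, Matrix.of_apply, Equiv.symm_apply_apply, Matrix.one_apply]
    have hinj : ∀ b b', ι b = ι b' ↔ b = b' := fun b b' => (Fin.castLE_injective hr).eq_iff
    rcases x with b | c <;> rcases y with b' | c' <;>
      simp only [hTg, hTg', Sum.elim_inl, Sum.elim_inr] <;>
      simp [hinj, eq_comm, apply_ite, -finSumFinEquiv_apply_left, -finSumFinEquiv_apply_right]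
  · apply le_antisymm
    · rintro _ ⟨p, rfl⟩
      have : G.vecMulLinear p = ∑ x, p x • G x := by
        ext1 j
        simp [Matrix.vecMul, dotProduct, Finset.sum_apply]
      rw [this]
      exact Submodule.sum_mem _ fun x _ => Submodule.smul_mem _ _ (hgmem _)
    · intro u hu
      have hu' : (reciprocalMatrix A₁ A₀).mulVec u = 0 := hu
      let w : (Fin κ ⊕ Fin r) ⊕ Fin m → F[X] := fun x => ∑ j, u j * C (T x j)
      have hwu : ∀ a : Fin κ, (if h : (a : ℕ) < r then w (Sum.inl (Sum.inr ⟨a, h⟩)) else 0)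
          + w (Sum.inl (Sum.inl a)) * X = 0 := fun a => by rw [← hw, hu']; rfl
      have hw0 : ∀ b : Fin r, w (Sum.inl (Sum.inr b)) = - (w (Sum.inl (Sum.inl (ι b))) * X) := by
        intro b
        have := hwu (ι b)
        have hlt : ((ι b : Fin κ) : ℕ) < r := b.2
        rw [dif_pos hlt] at this
        exact eq_neg_of_add_eq_zero_left this
      have hw1 : ∀ a : Fin κ, ¬ (a : ℕ) < r → w (Sum.inl (Sum.inl a)) = 0 := by
        intro a ha
        have := hwu a
        rw [dif_neg ha, zero_add] at this
        exact (mul_eq_zero.1 this).resolve_right X_ne_zero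
      have hsum : ∀ j, u j = ∑ x, w x * C (S j x) := by
        intro j
        have : ∀ x, w x * C (S j x) = ∑ l, u l * C (S j x * T x l) := fun x => by
          rw [Finset.sum_mul]
          exact Finset.sum_congr rfl fun l _ => by rw [C_mul]; ring
        simp_rw [this]
        rw [Finset.sum_comm]
        simp_rw [← Finset.mul_sum, ← map_sum, hSTe]
        simp
      refine ⟨fun x => Sum.elim (fun b => w (Sum.inl (Sum.inl (ι b)))) (fun c => w (Sum.inr c))
        (finSumFinEquiv.symm x), ?_⟩
      funext j
      rw [hsum j]
      rw [Matrix.vecMulLinear_apply, Matrix.vecMul, dotProduct]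
      rw [← Equiv.sum_comp finSumFinEquiv]
      simp only [G, Matrix.of_apply, Equiv.symm_apply_apply, Fintype.sum_sum_type, Sum.elim_inl,
        Sum.elim_inr, g, hw0]
      congr 1
      have hk : ∑ a : Fin κ, w (Sum.inl (Sum.inl a)) * C (S j (Sum.inl (Sum.inl a)))
          = ∑ b : Fin r, w (Sum.inl (Sum.inl (ι b))) * C (S j (Sum.inl (Sum.inl (ι b)))) := by
        symm
        refine Finset.sum_of_injOn ι (Fin.castLE_injective hr).injOn (by simp) ?_ (by simp)
        intro a _ ha
        rw [hw1, zero_mul]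
        intro hlt
        exact ha ⟨⟨a, hlt⟩, by simp, rfl⟩
      rw [hk, ← Finset.sum_add_distrib]
      exact Finset.sum_congr rfl fun b _ => by ring
  all_goals
    have hd1 : ∀ b, rowDegree G (finSumFinEquiv (Sum.inl b)) = 1 := by
      intro b
      unfold rowDegree
      simp only [G, Matrix.of_apply, Equiv.symm_apply_apply, g, Sum.elim_inl]
      apply le_antisymm
      · refine Finset.sup_le fun j _ => ?_
        compute_degree
      -- This column of `S` pairs to `1` with a row of `T`, so the coefficient of `D` does not
      -- vanish.
      · have hne : ∃ j, S j (Sum.inl (Sum.inr b)) ≠ 0 := by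
          by_contra! hcon
          have := hTSe (Sum.inl (Sum.inr b)) (Sum.inl (Sum.inr b))
          simp [hcon] at this
        obtain ⟨j, hj⟩ := hne
        refine le_trans ?_ (Finset.le_sup (Finset.mem_univ j))
        apply le_natDegree_of_ne_zero
        simpa [coeff_C] using hj
    have hd0 : ∀ c, rowDegree G (finSumFinEquiv (Sum.inr c)) = 0 := by
      intro c
      unfold rowDegree
      simp [G, g]
  · unfold overallLength
    rw [← Equiv.sum_comp finSumFinEquiv, Fintype.sum_sum_type]
    simp only [hd1, hd0]
    simp
  · unfold memory
    apply le_antisymm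
    · refine Finset.sup_le fun x _ => ?_
      obtain ⟨x, rfl⟩ := finSumFinEquiv.surjective x
      rcases x with b | c
      · rw [hd1]
      · rw [hd0]; exact zero_le_one
    · rw [← hd1 ⟨0, hr0⟩]
      exact Finset.le_sup (f := fun x => rowDegree G x) (Finset.mem_univ _)

theorem hasParameters_checkCode [DecidableEq F] (hr : r ≤ κ) (hr0 : 0 < r)
    (hA : Function.Surjective (Matrix.fromRows A₁ A₀).mulVec) (hn : κ + r + m = n)
    {d d₁ d₀ : ℕ} (hd : d ≤ d₁ + d₀)
    (h : ∀ c, A₁.mulVec c = 0 → A₀.mulVec c = 0 → c ≠ 0 → d ≤ hammingNorm c)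
    (h₁ : ∀ c, A₁.mulVec c = 0 → c ≠ 0 → d₁ ≤ hammingNorm c)
    (h₀ : ∀ c, A₀.mulVec c = 0 → c ≠ 0 → d₀ ≤ hammingNorm c)
    (hex : ∃ c, A₁.mulVec c = 0 ∧ A₀.mulVec c = 0 ∧ c ≠ 0 ∧ hammingNorm c ≤ d) :
    HasParameters (checkCode A₁ A₀) (r + m) r 1 d := by
  refine ⟨?_, ?_, ?_⟩
  · obtain ⟨G, hG, hC, hl, hm⟩ := exists_generator hr hr0 hA hn
    refine ⟨G, ⟨hG, fun G' hG' hC' => ?_⟩, hC, hl, hm⟩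
    rw [hl]
    exact le_overallLength hr hA hn hG' (hC'.trans hC)
  · obtain ⟨c, hc1, hc0, hc, hcd⟩ := hex
    refine ⟨fun j => C (c j), (const_mem_checkCode_iff hr).2 ⟨hc1, hc0⟩, ?_, ?_⟩
    · intro h0
      exact hc (funext fun j => C_eq_zero.1 (congrFun h0 j))
    · rw [weight_const]
      exact le_antisymm hcd (h c hc1 hc0 hc)
  · rintro _ ⟨u, hu, hu0, rfl⟩
    exact le_weight_of_mem_checkCode hr hd h h₁ h₀ hu hu0

end UnitMemory

/-! ### The Hermitian dual as the kernel of the reciprocal matrix. -/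

section Hermitian

variable {F : Type*} [Field F] {κ r n q : ℕ}

/-- Both sums extend to the union of the supports. Summing over `v` allows monomials to be
substituted there. -/
theorem hermitianForm_eq_sum_support (u v : Fin n → F[X]) (σ : F →+* F)
    (hσ : ∀ x, σ x = x ^ q) :
    hermitianForm q u v = ∑ j, (v j).sum fun t b => (u j).coeff t * σ b := by
  unfold hermitianForm
  refine Finset.sum_congr rfl fun j _ => ?_
  simp only [← hσ]
  rw [sum_def, sum_def]
  have h1 := Finset.sum_subset (Finset.subset_union_left (s₁ := (u j).support)
    (s₂ := (v j).support)) (f := fun t => (u j).coeff t * σ ((v j).coeff t))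
    (fun t _ ht => by rw [notMem_support_iff.1 ht, zero_mul])
  have h2 := Finset.sum_subset (Finset.subset_union_right (s₁ := (u j).support)
    (s₂ := (v j).support)) (f := fun t => (u j).coeff t * σ ((v j).coeff t))
    (fun t _ ht => by rw [notMem_support_iff.1 ht, map_zero, mul_zero])
  rw [h1, h2]

theorem hermitianForm_add_right (u v w : Fin n → F[X]) (σ : F →+* F) (hσ : ∀ x, σ x = x ^ q) :
    hermitianForm q u (v + w) = hermitianForm q u v + hermitianForm q u w := by
  unfold hermitianForm
  rw [← Finset.sum_add_distrib]
  refine Finset.sum_congr rfl fun j _ => ?_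
  simp only [← hσ, sum_def, ← Finset.sum_add_distrib]
  exact Finset.sum_congr rfl fun t _ => by simp [mul_add]

/-- Row `a` shifted by `D^s` meets coefficient `s` of `p u` through `H₁` and coefficient `s + 1`
through `H₀`. As a convolution this needs the two matrices in reversed order. -/
theorem hermitianForm_monomial_smul (u : Fin n → F[X]) (σ : F →+* F) (hσ : ∀ x, σ x = x ^ q)
    (p : F[X]) (s : ℕ) (c : F) (H₁ : Matrix (Fin κ) (Fin n) F) (H₀ : Matrix (Fin r) (Fin n) F)
    (a : Fin κ) :
    hermitianForm q (p • u) (monomial s c • unitMemoryMatrix H₁ H₀ a)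
      = σ c * (p * (reciprocalMatrix (H₁.map σ) (H₀.map σ)).mulVec u a).coeff (s + 1) := by
  rw [hermitianForm_eq_sum_support _ _ σ hσ]
  simp only [Matrix.mulVec, dotProduct, Finset.mul_sum, finsetSum_coeff]
  refine Finset.sum_congr rfl fun j _ => ?_
  have hpad : padRows κ (H₀.map σ) a j = σ (padRows κ H₀ a j) := by
    unfold padRows
    simp only [Matrix.of_apply]
    split_ifs <;> simp
  have hv : (monomial s c • unitMemoryMatrix H₁ H₀ a) j
      = monomial s (c * H₁ a j) + monomial (s + 1) (c * padRows κ H₀ a j) := by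
    simp [unitMemoryMatrix, mul_add, monomial_mul_C, ← mul_assoc, monomial_mul_X]
  rw [hv, sum_add_index _ _ _ (by simp) (by simp [mul_add]), sum_monomial_index _ _ (by simp),
    sum_monomial_index _ _ (by simp)]
  have hp : p * (reciprocalMatrix (H₁.map σ) (H₀.map σ) a j * u j)
      = C (σ (padRows κ H₀ a j)) * (p * u j) + C (σ (H₁ a j)) * ((p * u j) * X) := by
    simp only [reciprocalMatrix, Matrix.of_apply, hpad, Matrix.map_apply]
    ring
  rw [hp, coeff_add, coeff_C_mul, coeff_C_mul, coeff_mul_X]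
  simp only [Pi.smul_apply, smul_eq_mul, map_mul]
  ring

/-- The Hermitian dual of the code generated by `H₁ + H̃₀ D` has the parity check matrix
`H̃₀^σ + H₁^σ D`, where `σ` is the `q`-th power map. -/
theorem hermitianDual_rowModule (σ : F →+* F) (hσ : ∀ x, σ x = x ^ q)
    (H₁ : Matrix (Fin κ) (Fin n) F) (H₀ : Matrix (Fin r) (Fin n) F) :
    hermitianDual q (rowModule (unitMemoryMatrix H₁ H₀))
      = checkCode (H₁.map σ) (H₀.map σ) := by
  ext u
  constructor
  · intro hu
    refine show (reciprocalMatrix (H₁.map σ) (H₀.map σ)).mulVec u = 0 from funext fun a => ?_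
    ext s
    -- The multiplier `X` offsets the shift `s + 1`, so that coefficient `0` is reached as well.
    have := hu X (monomial s 1 • unitMemoryMatrix H₁ H₀ a)
      (Submodule.smul_mem _ _ ⟨Pi.single a 1, by simp; rfl⟩)
    rw [hermitianForm_monomial_smul _ σ hσ, map_one, one_mul, coeff_X_mul] at this
    exact this
  · intro hu p v hv
    have hu' : (reciprocalMatrix (H₁.map σ) (H₀.map σ)).mulVec u = 0 := hu
    obtain ⟨w, rfl⟩ := hv
    let B : (Fin n → F[X]) →+ F :=
      AddMonoidHom.mk' (fun v => hermitianForm q (p • u) v)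
        fun v w => hermitianForm_add_right _ v w σ hσ
    change B _ = 0
    have hw : (unitMemoryMatrix H₁ H₀).vecMulLinear w = ∑ a, w a • unitMemoryMatrix H₁ H₀ a := by
      ext1 j
      simp [Matrix.vecMul, dotProduct, Finset.sum_apply]
    rw [hw, map_sum]
    refine Finset.sum_eq_zero fun a _ => ?_
    induction w a using Polynomial.induction_on' with
    | add f g hf hg => rw [add_smul, map_add, hf, hg, add_zero]
    | monomial s c =>
      change hermitianForm q _ _ = 0
      rw [hermitianForm_monomial_smul _ σ hσ, hu']
      simp

end Hermitian

/-! ### Negacyclic codes, parity checks by residues, and the BCH bound. -/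

section Negacyclic

variable {F : Type*} [Field F] {n : ℕ}

/-- The polynomial `c_0 + c_1 x + ⋯ + c_{n-1} x^{n-1}`. -/
def vecPoly (c : Fin n → F) : F[X] := ∑ j, C (c j) * X ^ (j : ℕ)

theorem coeff_vecPoly (c : Fin n → F) (j : Fin n) : (vecPoly c).coeff j = c j := by
  simp [vecPoly, coeff_X_pow, Fin.val_inj]

theorem degree_vecPoly_lt (c : Fin n → F) : (vecPoly c).degree < n :=
  (degree_sum_le _ _).trans_lt <| (Finset.sup_lt_iff (WithBot.bot_lt_coe n)).2 fun j _ =>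
    (degree_C_mul_X_pow_le _ _).trans_lt (WithBot.coe_lt_coe.2 j.2)

theorem vecPoly_coeff {p : F[X]} (hp : p.degree < n) :
    vecPoly (fun j : Fin n => p.coeff j) = p := by
  ext t
  by_cases ht : t < n
  · exact coeff_vecPoly _ ⟨t, ht⟩
  · have h1 : (n : WithBot ℕ) ≤ t := by exact_mod_cast not_lt.1 ht
    rw [coeff_eq_zero_of_degree_lt (hp.trans_le h1),
      coeff_eq_zero_of_degree_lt ((degree_vecPoly_lt _).trans_le h1)]

/-- As `g` divides the modulus, divisibility in the quotient ring lifts to `F[X]`. -/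
theorem mem_negacyclicCode_iff {g : F[X]} (hg : g ∣ X ^ n + 1) (c : Fin n → F) :
    c ∈ negacyclicCode n g ↔ g ∣ vecPoly c := by
  have h1 : toNegacyclicRing F n c = AdjoinRoot.mk (X ^ n + 1 : F[X]) (vecPoly c) := by
    simp [toNegacyclicRing, Fintype.linearCombination_apply, vecPoly, Algebra.smul_def,
      AdjoinRoot.algebraMap_eq]
  unfold negacyclicCode
  rw [Submodule.mem_comap, Submodule.restrictScalars_mem, h1, Ideal.mem_span_singleton]
  constructor
  · rintro ⟨s, hs⟩
    obtain ⟨s, rfl⟩ := AdjoinRoot.mk_surjective s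
    rw [← map_mul, AdjoinRoot.mk_eq_mk] at hs
    have := hg.trans hs
    exact (dvd_sub_left (dvd_mul_right g s)).1 this
  · exact fun h => map_dvd _ h

/-- The matrix whose columns are the residues of `x^j` modulo `g`. -/
def residueMatrix (r n : ℕ) (g : F[X]) : Matrix (Fin r) (Fin n) F :=
  Matrix.of fun a j => ((X ^ (j : ℕ)) %ₘ g).coeff a

theorem residueMatrix_mulVec {r : ℕ} (g : F[X]) (c : Fin n → F) (a : Fin r) :
    (residueMatrix r n g).mulVec c a = (vecPoly c %ₘ g).coeff a := by
  have : vecPoly c %ₘ g = ∑ j, c j • ((X ^ (j : ℕ)) %ₘ g) := by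
    change modByMonicHom g _ = _
    simp only [vecPoly, map_sum, ← smul_eq_C_mul, map_smul]
    rfl
  rw [this, finsetSum_coeff]
  simp [residueMatrix, Matrix.mulVec, dotProduct, mul_comm]

theorem residueMatrix_mulVec_eq_zero_iff {r : ℕ} {g : F[X]} (hg : g.Monic)
    (hr : g.natDegree = r) (c : Fin n → F) :
    (residueMatrix r n g).mulVec c = 0 ↔ g ∣ vecPoly c := by
  rw [← modByMonic_eq_zero_iff_dvd hg]
  constructor
  · intro h
    have hd : (vecPoly c %ₘ g).degree < r := by
      rw [← hr, ← degree_eq_natDegree hg.ne_zero]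
      exact degree_modByMonic_lt _ hg
    rw [← vecPoly_coeff hd]
    have : (fun j : Fin r => (vecPoly c %ₘ g).coeff j) = 0 := by
      rw [← h]; funext a; rw [residueMatrix_mulVec]
    rw [this]
    simp [vecPoly]
  · intro h
    funext a
    rw [residueMatrix_mulVec, h]
    simp

/-- Chinese remainder theorem: residues modulo `f` and `g` can be prescribed together by a
polynomial of degree below `r + s ≤ n`. -/
theorem fromRows_residueMatrix_surjective {r s : ℕ} {f g : F[X]} (hf : f.Monic) (hg : g.Monic)
    (hr : f.natDegree = r) (hs : g.natDegree = s) (hfg : IsCoprime f g) (hn : r + s ≤ n) :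
    Function.Surjective
      (Matrix.fromRows (residueMatrix r n f) (residueMatrix s n g)).mulVec := by
  intro v
  obtain ⟨a, b, hab⟩ := hfg
  set v₁ : F[X] := vecPoly fun x : Fin r => v (Sum.inl x)
  set v₀ : F[X] := vecPoly fun x : Fin s => v (Sum.inr x)
  let p := (v₁ * (b * g) + v₀ * (a * f)) %ₘ (f * g)
  have hfgm := hf.mul hg
  have hp : p.degree < n := by
    refine (degree_modByMonic_lt _ hfgm).trans_le ?_
    rw [degree_eq_natDegree hfgm.ne_zero, hf.natDegree_mul hg, hr, hs]
    exact_mod_cast hn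
  have hpd : f * g ∣ p - (v₁ * (b * g) + v₀ * (a * f)) := by
    refine ⟨-((v₁ * (b * g) + v₀ * (a * f)) /ₘ (f * g)), ?_⟩
    have := modByMonic_add_div (v₁ * (b * g) + v₀ * (a * f)) (f * g)
    simp only [p]
    linear_combination this
  have hpf : p %ₘ f = v₁ := by
    have hd : f ∣ p - v₁ := by
      have h1 := (dvd_mul_right f g).trans hpd
      have h2 : p - v₁ = (p - (v₁ * (b * g) + v₀ * (a * f))) + f * (v₀ * a - v₁ * a) := by
        linear_combination v₁ * hab
      rw [h2]
      exact dvd_add h1 (dvd_mul_right _ _)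
    rw [← (modByMonic_eq_self_iff hf).2 (show v₁.degree < f.degree by
      rw [degree_eq_natDegree hf.ne_zero, hr]; exact degree_vecPoly_lt _)]
    exact (modByMonic_eq_of_dvd_sub hf hd)
  have hpg : p %ₘ g = v₀ := by
    have hd : g ∣ p - v₀ := by
      have h1 := (dvd_mul_left g f).trans hpd
      have h2 : p - v₀ = (p - (v₁ * (b * g) + v₀ * (a * f))) + g * (v₁ * b - v₀ * b) := by
        linear_combination v₀ * hab
      rw [h2]
      exact dvd_add h1 (dvd_mul_right _ _)
    rw [← (modByMonic_eq_self_iff hg).2 (show v₀.degree < g.degree by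
      rw [degree_eq_natDegree hg.ne_zero, hs]; exact degree_vecPoly_lt _)]
    exact (modByMonic_eq_of_dvd_sub hg hd)
  refine ⟨fun j => p.coeff j, ?_⟩
  rw [Matrix.fromRows_mulVec]
  funext x
  rcases x with x | x
  · rw [Sum.elim_inl, residueMatrix_mulVec, vecPoly_coeff hp, hpf]
    exact coeff_vecPoly _ x
  · rw [Sum.elim_inr, residueMatrix_mulVec, vecPoly_coeff hp, hpg]
    exact coeff_vecPoly _ x

section Distance

variable {K : Type*} [Field K] [Algebra F K]

theorem aeval_vecPoly (c : Fin n → F) (x : K) :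
    aeval x (vecPoly c) = ∑ j, algebraMap F K (c j) * x ^ (j : ℕ) := by
  simp [vecPoly]

/-- The BCH bound: a nonzero word with zeros `γ ζ^s`, `s < δ`, has weight greater than `δ`. -/
theorem lt_hammingNorm_of_consecutive_zeros [DecidableEq F] {γ ζ : K} {δ : ℕ} (hγ : γ ≠ 0)
    (hζ : IsPrimitiveRoot ζ n) {c : Fin n → F} (hc : c ≠ 0)
    (h : ∀ s < δ, aeval (γ * ζ ^ s) (vecPoly c) = 0) : δ < hammingNorm c := by
  classical
  by_contra! hle
  let S := Finset.univ.filter fun j => c j ≠ 0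
  have hS : S.card ≤ δ := hle
  obtain ⟨j₀, hj₀⟩ := Function.ne_iff.1 hc
  have hj₀S : j₀ ∈ S := Finset.mem_filter.2 ⟨Finset.mem_univ _, hj₀⟩
  let d : Fin n → K := fun j => algebraMap F K (c j) * γ ^ (j : ℕ)
  have hev : ∀ p : K[X], p.natDegree < δ → ∑ j, d j * p.eval (ζ ^ (j : ℕ)) = 0 := by
    intro p hp
    simp_rw [eval_eq_sum_range, Finset.mul_sum]
    rw [Finset.sum_comm]
    refine Finset.sum_eq_zero fun s hs => ?_
    have := h s (by rw [Finset.mem_range] at hs; omega)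
    rw [aeval_vecPoly] at this
    rw [← mul_zero (p.coeff s), ← this, Finset.mul_sum]
    refine Finset.sum_congr rfl fun j _ => ?_
    simp only [d, mul_pow, ← pow_mul, mul_comm s]
    ring
  -- This `p` kills every term of the sum in `hev` except that of `j₀`, and its degree `|S| - 1` is
  -- below `δ`.
  let p : K[X] := ∏ k ∈ S.erase j₀, (X - C (ζ ^ (k : ℕ)))
  have hpd : p.natDegree < δ := by
    rw [natDegree_prod_of_monic _ _ fun k _ => monic_X_sub_C _]
    simp only [natDegree_X_sub_C, Finset.sum_const, smul_eq_mul, mul_one]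
    have := Finset.card_erase_lt_of_mem hj₀S
    omega
  have h1 := hev p hpd
  rw [Finset.sum_eq_single j₀] at h1
  · have hd0 : d j₀ ≠ 0 := mul_ne_zero (by simpa using hj₀) (pow_ne_zero _ hγ)
    have hp0 := (mul_eq_zero.1 h1).resolve_left hd0
    rw [eval_prod, Finset.prod_eq_zero_iff] at hp0
    obtain ⟨k, hk, hk0⟩ := hp0
    rw [eval_sub, eval_X, eval_C, sub_eq_zero] at hk0
    exact (Finset.mem_erase.1 hk).1 (Fin.ext (hζ.pow_inj j₀.2 k.2 hk0)).symm
  · intro j _ hj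
    by_cases hcj : c j = 0
    · simp [d, hcj]
    · have : p.eval (ζ ^ (j : ℕ)) = 0 := by
        rw [eval_prod]
        exact Finset.prod_eq_zero (Finset.mem_erase.2
          ⟨hj, Finset.mem_filter.2 ⟨Finset.mem_univ _, hcj⟩⟩) (by simp)
      rw [this, mul_zero]
  · simp

end Distance

end Negacyclic

/-! ### Minimal polynomials of `2n`-th roots of unity when `|F| + 1 = 2n`. -/

section Bch

variable {F : Type*} [Field F] [Fintype F] {K : Type*} [Field K] [Algebra F K]

/-- `X^|F| - X` already splits over `F`, so `K` contributes no new roots. -/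
theorem mem_range_algebraMap_of_pow_card {x : K} (hx : x ^ Fintype.card F = x) :
    x ∈ (algebraMap F K).range := by
  classical
  have h := FiniteField.roots_X_pow_card_sub_X F
  have hspl : (X ^ Fintype.card F - X : F[X]).Splits := by
    apply splits_iff_card_roots.2
    rw [h, FiniteField.X_pow_card_sub_X_natDegree_eq _ Fintype.one_lt_card]
    simp
  have hne : (X ^ Fintype.card F - X : F[X]) ≠ 0 :=
    FiniteField.X_pow_card_sub_X_ne_zero _ Fintype.one_lt_card
  have h2 := hspl.eq_prod_roots_of_monic (monic_X_pow_sub (by simpa using Fintype.one_lt_card))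
  have h3 : aeval x (X ^ Fintype.card F - X : F[X]) = 0 := by simp [hx]
  rw [h2, h, map_multiset_prod, Multiset.prod_eq_zero_iff] at h3
  simp only [Multiset.map_map, Multiset.mem_map, Function.comp] at h3
  obtain ⟨a, -, ha⟩ := h3
  refine ⟨a, ?_⟩
  rw [map_sub, aeval_X, aeval_C, sub_eq_zero] at ha
  exact ha.symm

variable {γ : K}

/-- The minimal polynomial of an element whose only other conjugate is its inverse. -/
theorem map_minpoly_of_pow_card_eq_inv (hγ : γ ^ Fintype.card F = γ⁻¹) (hne : γ⁻¹ ≠ γ) :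
    (minpoly F γ).map (algebraMap F K) = (X - C γ) * (X - C γ⁻¹) := by
  have hγ0 : γ ≠ 0 := by rintro rfl; simp at hne
  -- Frobenius swaps `γ` and `γ⁻¹`, so their sum descends to `F`; their product is `1`.
  have hs : (γ + γ⁻¹) ^ Fintype.card F = γ + γ⁻¹ := by
    obtain ⟨p, hp⟩ := CharP.exists F
    obtain ⟨m, hpp, hm⟩ := FiniteField.card F p
    have := Fact.mk hpp
    have : CharP K p := charP_of_injective_algebraMap (algebraMap F K).injective p
    rw [hm, add_pow_char_pow, ← hm, inv_pow, hγ, inv_inv, add_comm]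
  obtain ⟨a, ha⟩ := mem_range_algebraMap_of_pow_card hs
  let f : F[X] := X ^ 2 - C a * X + 1
  have hf : f.map (algebraMap F K) = (X - C γ) * (X - C γ⁻¹) := by
    have h1 : (C γ * C γ⁻¹ : K[X]) = 1 := by rw [← C_mul, mul_inv_cancel₀ hγ0, C_1]
    simp only [f, Polynomial.map_add, Polynomial.map_sub, Polynomial.map_mul, Polynomial.map_pow,
      map_X, map_C, Polynomial.map_one, ha, C_add]
    linear_combination -h1
  have hfm : f.Monic := by
    have : ((X - C γ) * (X - C γ⁻¹)).Monic := (monic_X_sub_C _).mul (monic_X_sub_C _)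
    rw [← hf] at this
    exact monic_of_injective (algebraMap F K).injective this
  have hfd : f.natDegree = 2 := by
    rw [← natDegree_map (algebraMap F K), hf, (monic_X_sub_C _).natDegree_mul (monic_X_sub_C _)]
    simp
  have hf0 : aeval γ f = 0 := by
    rw [← eval_map_algebraMap, hf]; simp
  have hint : IsIntegral F γ := ⟨f, hfm, hf0⟩
  have h2 : 2 ≤ (minpoly F γ).natDegree := by
    rw [minpoly.two_le_natDegree_iff hint]
    rintro ⟨b, rfl⟩
    rw [← map_pow, FiniteField.pow_card] at hγ
    exact hne hγ.symm
  have : f = minpoly F γ :=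
    (eq_of_monic_of_dvd_of_natDegree_le (minpoly.monic hint) hfm (minpoly.dvd F γ hf0)
      (by omega))
  rw [← this, hf]

variable {n : ℕ} {β : K}

theorem pow_half_eq_neg_one (hn : n ≠ 0) (hβ : IsPrimitiveRoot β (2 * n)) : β ^ n = -1 := by
  have h1 : (β ^ n) ^ 2 = 1 := by rw [← pow_mul, mul_comm, hβ.pow_eq_one]
  exact (sq_eq_one_iff.1 h1).resolve_left (hβ.pow_ne_one_of_pos_of_lt hn (by omega))

theorem pow_mul_pow_ne_one {s t : ℕ} (hβ : IsPrimitiveRoot β (2 * n)) (h0 : 0 < s + t)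
    (hst : s + t < n) : β ^ (n + 2 * s) * β ^ (n + 2 * t) ≠ 1 := by
  intro h
  rw [← pow_add] at h
  have h1 := hβ.dvd_of_pow_eq_one _ h
  have h2 : 2 * n ∣ 2 * (s + t) := by
    have h3 : n + 2 * s + (n + 2 * t) = 2 * n + 2 * (s + t) := by ring
    rw [h3] at h1
    exact (Nat.dvd_add_right (dvd_refl _)).1 h1
  have := Nat.le_of_dvd (by omega) h2
  omega

theorem map_minpoly_pow (hF : Fintype.card F + 1 = 2 * n)
    (hβ : IsPrimitiveRoot β (2 * n)) {t : ℕ} (ht : 0 < t) (htn : 2 * t < n) :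
    (minpoly F (β ^ (n + 2 * t))).map (algebraMap F K)
      = (X - C (β ^ (n + 2 * t))) * (X - C (β ^ (n + 2 * t))⁻¹) := by
  have h0 : β ≠ 0 := hβ.ne_zero (by omega)
  apply map_minpoly_of_pow_card_eq_inv
  · apply eq_inv_of_mul_eq_one_left
    rw [← pow_succ, hF, ← pow_mul, mul_comm, pow_mul, hβ.pow_eq_one, one_pow]
  · intro h
    refine pow_mul_pow_ne_one (s := t) (t := t) hβ (by omega) (by omega) ?_
    nth_rw 1 [← h]
    exact inv_mul_cancel₀ (pow_ne_zero _ h0)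

theorem isIntegral_pow (hF : Fintype.card F + 1 = 2 * n)
    (hβ : IsPrimitiveRoot β (2 * n)) (j : ℕ) : IsIntegral F (β ^ j) := by
  refine IsIntegral.pow ⟨X ^ (2 * n) - 1, monic_X_pow_sub_C 1 (by omega), ?_⟩ j
  simp [hβ.pow_eq_one]

theorem natDegree_minpoly_pow (hF : Fintype.card F + 1 = 2 * n)
    (hβ : IsPrimitiveRoot β (2 * n)) {t : ℕ} (ht : 0 < t) (htn : 2 * t < n) :
    (minpoly F (β ^ (n + 2 * t))).natDegree = 2 := by
  rw [← natDegree_map (algebraMap F K), map_minpoly_pow hF hβ ht htn,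
    (monic_X_sub_C _).natDegree_mul (monic_X_sub_C _), natDegree_X_sub_C, natDegree_X_sub_C]

theorem natDegree_bchGenerator (hF : Fintype.card F + 1 = 2 * n)
    (hβ : IsPrimitiveRoot β (2 * n)) {s : ℕ} (hs : 2 * (s + 1) ≤ n) :
    (bchGenerator F β n (s + 1)).natDegree = 2 * s + 1 := by
  induction s with
  | zero =>
    -- The factor `M^(n) = X + 1` is the only linear one, whence the odd degree.
    have : β ^ n = algebraMap F K (-1) := by
      rw [pow_half_eq_neg_one (by omega) hβ]; simp
    simp [bchGenerator, this, minpoly.eq_X_sub_C, -map_neg]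
  | succ s ih =>
    unfold bchGenerator at ih ⊢
    rw [Finset.prod_range_succ, Monic.natDegree_mul
      (monic_prod_of_monic _ _ fun t _ => minpoly.monic (isIntegral_pow hF hβ _))
      (minpoly.monic (isIntegral_pow hF hβ _)), ih (by omega),
      natDegree_minpoly_pow hF hβ (by omega) (by omega)]
    ring

theorem monic_bchGenerator (hF : Fintype.card F + 1 = 2 * n)
    (hβ : IsPrimitiveRoot β (2 * n)) (b s : ℕ) : (bchGenerator F β b s).Monic :=
  monic_prod_of_monic _ _ fun _ _ => minpoly.monic (isIntegral_pow hF hβ _)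

theorem isCoprime_minpoly_of_lt (hF : Fintype.card F + 1 = 2 * n)
    (hβ : IsPrimitiveRoot β (2 * n)) {s t : ℕ} (hst : s < t) (ht : 2 * t < n) :
    IsCoprime (minpoly F (β ^ (n + 2 * s))) (minpoly F (β ^ (n + 2 * t))) := by
  rw [(minpoly.irreducible (isIntegral_pow hF hβ _)).coprime_iff_not_dvd]
  intro hd
  have h1 : aeval (β ^ (n + 2 * s)) (minpoly F (β ^ (n + 2 * t))) = 0 :=
    aeval_eq_zero_of_dvd_aeval_eq_zero hd (minpoly.aeval _ _)
  rw [← eval_map_algebraMap, map_minpoly_pow hF hβ (by omega) ht, eval_mul, mul_eq_zero] at h1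
  simp only [eval_sub, eval_X, eval_C, sub_eq_zero] at h1
  rcases h1 with h1 | h1
  · have := hβ.pow_inj (by omega) (by omega) h1
    omega
  · refine pow_mul_pow_ne_one (s := s) (t := t) hβ (by omega) (by omega) ?_
    rw [h1]
    exact inv_mul_cancel₀ (pow_ne_zero _ (hβ.ne_zero (by omega)))

theorem minpoly_pow_dvd (hF : Fintype.card F + 1 = 2 * n)
    (hβ : IsPrimitiveRoot β (2 * n)) (hodd : Odd n) (t : ℕ) :
    minpoly F (β ^ (n + 2 * t)) ∣ X ^ n + 1 := by
  apply minpoly.dvd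
  have : Odd (n + 2 * t) := hodd.add_even (even_two_mul t)
  simp only [map_add, map_pow, aeval_X, map_one]
  rw [← pow_mul, mul_comm, pow_mul, pow_half_eq_neg_one (by omega) hβ, this.neg_one_pow,
    neg_add_cancel]

theorem bchGenerator_dvd (hF : Fintype.card F + 1 = 2 * n)
    (hβ : IsPrimitiveRoot β (2 * n)) (hodd : Odd n) {s : ℕ} (hs : 2 * s ≤ n) :
    bchGenerator F β n s ∣ X ^ n + 1 := by
  refine Finset.prod_dvd_of_coprime ?_ fun t _ => minpoly_pow_dvd hF hβ hodd t
  intro a ha b hb hab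
  simp only [Finset.coe_range, Set.mem_Iio] at ha hb
  rcases hab.lt_or_gt with h | h
  · exact isCoprime_minpoly_of_lt hF hβ h (by omega)
  · exact (isCoprime_minpoly_of_lt hF hβ h (by omega)).symm

theorem isCoprime_bchGenerator (hF : Fintype.card F + 1 = 2 * n)
    (hβ : IsPrimitiveRoot β (2 * n)) {s : ℕ} (hs : 2 * s < n) :
    IsCoprime (bchGenerator F β n s) (minpoly F (β ^ (n + 2 * s))) :=
  IsCoprime.prod_left fun _ ht =>
    isCoprime_minpoly_of_lt hF hβ (Finset.mem_range.1 ht) hs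

theorem lt_hammingNorm_of_minpoly_dvd (hF : Fintype.card F + 1 = 2 * n)
    (hβ : IsPrimitiveRoot β (2 * n)) [DecidableEq F] {t : ℕ} {c : Fin n → F}
    (h : minpoly F (β ^ (n + 2 * t)) ∣ vecPoly c) (hc : c ≠ 0) : 1 < hammingNorm c := by
  have h0 : β ≠ 0 := hβ.ne_zero (by omega)
  have hζ : IsPrimitiveRoot (β ^ 2) n := hβ.pow (by omega) rfl
  refine lt_hammingNorm_of_consecutive_zeros (γ := β ^ (n + 2 * t)) (pow_ne_zero _ h0)
    hζ hc fun x hx => ?_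
  obtain rfl : x = 0 := by omega
  simpa using aeval_eq_zero_of_dvd_aeval_eq_zero h (minpoly.aeval _ _)

/-- Since `β^(n-2k)` is the inverse of `β^(n+2k)`, hence its conjugate, the zeros run from
`β^(n-2s)` to `β^(n+2s)` in steps of `β²`. -/
theorem lt_hammingNorm_of_bchGenerator_dvd (hF : Fintype.card F + 1 = 2 * n)
    (hβ : IsPrimitiveRoot β (2 * n)) [DecidableEq F] {s : ℕ} (hs : 2 * (s + 1) ≤ n)
    {c : Fin n → F} (h : bchGenerator F β n (s + 1) ∣ vecPoly c) (hc : c ≠ 0) :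
    2 * s + 1 < hammingNorm c := by
  have h0 : β ≠ 0 := hβ.ne_zero (by omega)
  have hζ : IsPrimitiveRoot (β ^ 2) n := hβ.pow (by omega) rfl
  have hd : ∀ t, t ≤ s → minpoly F (β ^ (n + 2 * t)) ∣ vecPoly c := fun t ht =>
    (Finset.dvd_prod_of_mem (fun t => minpoly F (β ^ (n + 2 * t)))
      (Finset.mem_range.2 (by omega : t < s + 1))).trans h
  refine lt_hammingNorm_of_consecutive_zeros (γ := β ^ (n - 2 * s)) (pow_ne_zero _ h0)
    hζ hc fun x hx => ?_
  rw [← pow_mul, ← pow_add]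
  rcases le_or_gt s x with hsx | hsx
  · have : n - 2 * s + 2 * x = n + 2 * (x - s) := by omega
    rw [this]
    exact aeval_eq_zero_of_dvd_aeval_eq_zero (hd _ (by omega)) (minpoly.aeval _ _)
  · have : β ^ (n - 2 * s + 2 * x) = (β ^ (n + 2 * (s - x)))⁻¹ := by
      apply eq_inv_of_mul_eq_one_left
      have he : n - 2 * s + 2 * x + (n + 2 * (s - x)) = 2 * n := by omega
      rw [← pow_add, he, hβ.pow_eq_one]
    rw [this]
    refine aeval_eq_zero_of_dvd_aeval_eq_zero (hd (s - x) (by omega)) ?_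
    rw [← eval_map_algebraMap, map_minpoly_pow hF hβ (by omega) (by omega)]
    simp

end Bch

/-- The word is the coefficient vector of `g` itself. -/
theorem exists_hammingNorm_le {F : Type*} [Field F] [DecidableEq F] {n : ℕ} {g : F[X]}
    (hg : g ≠ 0) (hn : g.natDegree < n) :
    ∃ c : Fin n → F, g ∣ vecPoly c ∧ c ≠ 0 ∧ hammingNorm c ≤ g.natDegree + 1 := by
  have hv : vecPoly (fun j : Fin n => g.coeff j) = g :=
    vecPoly_coeff ((natDegree_lt_iff_degree_lt hg).1 hn)
  refine ⟨fun j => g.coeff j, hv.symm ▸ dvd_refl _, ?_, ?_⟩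
  · intro h
    rw [h] at hv
    exact hg (by rw [← hv]; simp [vecPoly])
  · refine le_trans ?_ (card_supp_le_succ_natDegree g)
    refine Finset.card_le_card_of_injOn Fin.val (fun j hj => ?_) Fin.val_injective.injOn
    simpa using hj

/-! ### Transfer of kernels, surjectivity and weights along `σ`. -/

section Conjugation

variable {F : Type*} [Field F] {n : ℕ} {ι : Type*} (σ : F →+* F)

theorem map_mulVec_comp (H : Matrix ι (Fin n) F) (c : Fin n → F) :
    (H.map σ).mulVec (fun j => σ (c j)) = fun a => σ (H.mulVec c a) := by
  funext a
  simp [Matrix.mulVec, dotProduct]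

theorem map_mulVec_eq_zero_iff (hσ : ∀ x, σ (σ x) = x) (H : Matrix ι (Fin n) F)
    (c : Fin n → F) : (H.map σ).mulVec c = 0 ↔ H.mulVec (fun j => σ (c j)) = 0 := by
  have h := map_mulVec_comp σ H fun j => σ (c j)
  simp only [hσ] at h
  rw [h]
  constructor
  · intro h0
    funext a
    exact (map_eq_zero σ).1 (congrFun h0 a)
  · intro h0
    rw [h0]
    funext a
    simp

theorem map_mulVec_surjective (hσ : ∀ x, σ (σ x) = x) {H : Matrix ι (Fin n) F}
    (hH : Function.Surjective H.mulVec) : Function.Surjective (H.map σ).mulVec := by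
  intro v
  obtain ⟨c, hc⟩ := hH fun a => σ (v a)
  refine ⟨fun j => σ (c j), ?_⟩
  rw [map_mulVec_comp, hc]
  funext a
  exact hσ _

theorem hammingNorm_map [DecidableEq F] (c : Fin n → F) :
    hammingNorm (fun j => σ (c j)) = hammingNorm c := by
  simp [hammingNorm]

theorem map_comp_ne_zero {c : Fin n → F} (hc : c ≠ 0) : (fun j => σ (c j)) ≠ 0 := by
  intro h
  exact hc (funext fun j => (map_eq_zero σ).1 (congrFun h j))

end Conjugation

/-- The base prime of `q` vanishes in `F`, so the `q`-th power map is an iterated Frobenius; it is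
an involution as `x^(q²) = x`. -/
theorem exists_pow_ringHom {F : Type*} [Field F] [Fintype F] {q : ℕ} (hq : IsPrimePow q)
    (hF : Fintype.card F = q ^ 2) :
    ∃ σ : F →+* F, (∀ x, σ x = x ^ q) ∧ ∀ x, σ (σ x) = x := by
  obtain ⟨p, m, hp, -, rfl⟩ := hq
  have hp' := hp.nat_prime
  have hp0 : (p : F) = 0 := by
    have := Nat.cast_card_eq_zero F
    rw [hF, ← pow_mul, Nat.cast_pow] at this
    exact eq_zero_of_pow_eq_zero this
  have := (CharP.charP_iff_prime_eq_zero hp').2 hp0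
  have : ExpChar F p := ExpChar.prime hp'
  refine ⟨iterateFrobenius F p m, fun x => iterateFrobenius_def p m x, fun x => ?_⟩
  rw [iterateFrobenius_def, iterateFrobenius_def, ← pow_mul, ← sq, ← hF, FiniteField.pow_card]

end ConvCode

end

/-! ### Assembly of the main theorem. -/

open ConvCode in
theorem theorem6 {F : Type*} [Field F] [Fintype F] (q n i : ℕ)
    (hq : IsPrimePow q) (hodd : Odd q) (hq5 : 5 ≤ q) (hF : Fintype.card F = q ^ 2)
    (hn : n = (q ^ 2 + 1) / 2) (hi2 : 2 ≤ i) (hin : i ≤ (n - 1) / 2 - 1) :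
    ∃ V' : Submodule F[X] (Fin n → F[X]),
      ConvCode.IsMDS V' (n - 2 * i + 1) 2 1 (2 * i + 2) ∧
      ∃ (β : AlgebraicClosure F)
        (H₁ : Matrix (Fin (2 * i - 1)) (Fin n) F) (H₀ : Matrix (Fin 2) (Fin n) F),
        IsPrimitiveRoot β (2 * n) ∧
        ConvCode.IsParityCheck H₁
          (ConvCode.negacyclicCode n (ConvCode.bchGenerator F β n i)) ∧
        ConvCode.IsParityCheck H₀
          (ConvCode.negacyclicCode n (ConvCode.bchGenerator F β (n + 2 * i) 1)) ∧
        ConvCode.IsParityCheck (Matrix.fromRows H₁ H₀)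
          (ConvCode.negacyclicCode n (ConvCode.bchGenerator F β n (i + 1))) ∧
        V' = ConvCode.hermitianDual q
          (ConvCode.rowModule (ConvCode.unitMemoryMatrix H₁ H₀)) := by
  classical
  obtain ⟨a, ha⟩ := hodd
  -- An odd square is `1` modulo `4`, so `n` is odd; this makes each `β^(n+2t)` a root of `X^n + 1`.
  have hqq : q ^ 2 + 1 = 2 * (2 * (a * (a + 1)) + 1) := by rw [ha]; ring
  have hn1 : n = 2 * (a * (a + 1)) + 1 := by omega
  have hnodd : Odd n := ⟨_, hn1⟩
  have hcard : Fintype.card F + 1 = 2 * n := by rw [hF]; omega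
  have hin' : 2 * i + 3 ≤ n := by omega
  obtain ⟨s, rfl⟩ : ∃ s, i = s + 1 := ⟨i - 1, by omega⟩
  obtain ⟨σ, hσ, hσσ⟩ := exists_pow_ringHom hq hF
  -- In characteristic `p` one has `2n = |F| + 1 = 1`, so primitive `2n`-th roots exist.
  have hne : NeZero ((2 * n : ℕ) : AlgebraicClosure F) := by
    refine ⟨?_⟩
    have h0 : ((Fintype.card F : ℕ) : F) = 0 := Nat.cast_card_eq_zero F
    rw [← hcard, ← map_natCast (algebraMap F (AlgebraicClosure F))]
    rw [Nat.cast_succ, h0]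
    simp
  obtain ⟨β, hβ⟩ := HasEnoughRootsOfUnity.exists_primitiveRoot (AlgebraicClosure F) (2 * n)
  set g₁ := bchGenerator F β n (s + 1) with hg₁
  set g₀ := bchGenerator F β (n + 2 * (s + 1)) 1 with hg₀
  have hg₀' : g₀ = minpoly F (β ^ (n + 2 * (s + 1))) := by simp [hg₀, bchGenerator]
  have hg₂ : bchGenerator F β n (s + 1 + 1) = g₁ * g₀ := by
    rw [hg₀']
    exact Finset.prod_range_succ _ _
  have hm₁ : g₁.Monic := monic_bchGenerator hcard hβ _ _
  have hm₀ : g₀.Monic := monic_bchGenerator hcard hβ _ _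
  have hd₁ : g₁.natDegree = 2 * (s + 1) - 1 := by
    rw [natDegree_bchGenerator hcard hβ (by omega)]
    omega
  have hd₀ : g₀.natDegree = 2 := by
    rw [hg₀', natDegree_minpoly_pow hcard hβ (by omega) (by omega)]
  have hco : IsCoprime g₁ g₀ := hg₀' ▸ isCoprime_bchGenerator hcard hβ (by omega)
  have hdvd₁ : g₁ ∣ X ^ n + 1 := bchGenerator_dvd hcard hβ hnodd (by omega)
  have hdvd₀ : g₀ ∣ X ^ n + 1 := hg₀' ▸ minpoly_pow_dvd hcard hβ hnodd _
  have hdvd₂ : g₁ * g₀ ∣ X ^ n + 1 := hco.mul_dvd hdvd₁ hdvd₀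
  let H₁ : Matrix (Fin (2 * (s + 1) - 1)) (Fin n) F := residueMatrix _ n g₁
  let H₀ : Matrix (Fin 2) (Fin n) F := residueMatrix _ n g₀
  have hH₁ : ∀ c, H₁.mulVec c = 0 ↔ g₁ ∣ vecPoly c := residueMatrix_mulVec_eq_zero_iff hm₁ hd₁
  have hH₀ : ∀ c, H₀.mulVec c = 0 ↔ g₀ ∣ vecPoly c := residueMatrix_mulVec_eq_zero_iff hm₀ hd₀
  have hsurj : Function.Surjective (Matrix.fromRows H₁ H₀).mulVec :=
    fromRows_residueMatrix_surjective hm₁ hm₀ hd₁ hd₀ hco (by omega)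
  have hli := linearIndependent_row_of_surjective hsurj
  have hmul : ∀ p : F[X], g₁ * g₀ ∣ p ↔ g₁ ∣ p ∧ g₀ ∣ p := fun p =>
    ⟨fun h => ⟨(dvd_mul_right _ _).trans h, (dvd_mul_left _ _).trans h⟩,
      fun h => hco.mul_dvd h.1 h.2⟩
  have hparams : HasParameters (checkCode (H₁.map σ) (H₀.map σ))
      (2 + (n - 2 * (s + 1) - 1)) 2 1 (2 * (s + 1) + 2) := by
    have hsurj' : Function.Surjective (Matrix.fromRows (H₁.map σ) (H₀.map σ)).mulVec := by
      rw [← Matrix.fromRows_map]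
      exact map_mulVec_surjective σ hσσ hsurj
    -- The bound `2 ≤ i` ensures that `H₀` has no more rows than `H₁`.
    refine hasParameters_checkCode (d₁ := 2 * (s + 1)) (d₀ := 2) (by omega) (by omega) hsurj'
      (by omega) le_rfl ?_ ?_ ?_ ?_
    · intro c h1 h0 hc
      rw [map_mulVec_eq_zero_iff σ hσσ, hH₁] at h1
      rw [map_mulVec_eq_zero_iff σ hσσ, hH₀] at h0
      have := lt_hammingNorm_of_bchGenerator_dvd hcard hβ (s := s + 1) (by omega)
        (hg₂ ▸ (hmul _).2 ⟨h1, h0⟩) (map_comp_ne_zero σ hc)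
      rw [hammingNorm_map] at this
      omega
    · intro c h1 hc
      rw [map_mulVec_eq_zero_iff σ hσσ, hH₁] at h1
      have := lt_hammingNorm_of_bchGenerator_dvd hcard hβ (s := s) (by omega)
        h1 (map_comp_ne_zero σ hc)
      rw [hammingNorm_map] at this
      omega
    · intro c h0 hc
      rw [map_mulVec_eq_zero_iff σ hσσ, hH₀, hg₀'] at h0
      have := lt_hammingNorm_of_minpoly_dvd hcard hβ h0 (map_comp_ne_zero σ hc)
      rwa [hammingNorm_map] at this
    · have hd : (g₁ * g₀).natDegree = 2 * (s + 1) + 1 := by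
        rw [hm₁.natDegree_mul hm₀, hd₁, hd₀]
        omega
      obtain ⟨c, hgc, hc, hle⟩ := exists_hammingNorm_le (n := n) (hm₁.mul hm₀).ne_zero (by omega)
      refine ⟨fun j => σ (c j), ?_, ?_, map_comp_ne_zero σ hc, ?_⟩
      · rw [map_mulVec_eq_zero_iff σ hσσ]
        simp only [hσσ]
        exact (hH₁ c).2 ((hmul _).1 hgc).1
      · rw [map_mulVec_eq_zero_iff σ hσσ]
        simp only [hσσ]
        exact (hH₀ c).2 ((hmul _).1 hgc).2
      · rw [hammingNorm_map]
        omega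
  have hk : 2 + (n - 2 * (s + 1) - 1) = n - 2 * (s + 1) + 1 := by omega
  refine ⟨_, ⟨?_, ?_⟩, β, H₁, H₀, hβ, ⟨?_, ?_⟩, ⟨?_, ?_⟩, ⟨hli, ?_⟩, rfl⟩
  · rw [hermitianDual_rowModule σ hσ, ← hk]
    exact hparams
  -- The dimension exceeds the degree `2`, so the floor is `0` and the bound is `(2i - 1) + 2 + 1`.
  · rw [Nat.div_eq_of_lt (by omega)]
    omega
  · exact hli.comp Sum.inl Sum.inl_injective
  · intro c
    rw [mem_negacyclicCode_iff hdvd₁, hH₁]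
  · exact hli.comp Sum.inr Sum.inr_injective
  · intro c
    rw [mem_negacyclicCode_iff hdvd₀, hH₀]
  · intro c
    rw [hg₂, mem_negacyclicCode_iff hdvd₂, hmul, ← hH₁, ← hH₀, Matrix.fromRows_mulVec]
    constructor
    · rintro ⟨h1, h0⟩
      rw [h1, h0]
      funext x
      cases x <;> rfl
    · intro h
      exact ⟨funext fun x => congrFun h (Sum.inl x), funext fun x => congrFun h (Sum.inr x)⟩
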